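/- Let $K$ be a field and $n\ge 0$. A finite set $\mathcal B$ of monomials of $K[x_1,\dots,x_n]$ is called a polymatroid if (i) all members of $\mathcal B$ have the same degree and (ii) whenever $u=x_1^{a_1}\cdots x_n^{a_n}$ and $v=x_1^{b_1}\cdots x_n^{b_n}$ belong to $\mathcal B$ and $a_\xi>b_\xi$, there is $\rho$ with $a_\rho<b_\rho$ and $x_\rho(u/x_\xi)\in\mathcal B$. For a finite set $\mathcal B$ of monomials let $T_{\mathcal B}=K[z_w : w\in\mathcal B]$ be the polynomial ring with one variable for each element of $\mathcal B$; the toric ideal $J_{\mathcal B}$ is the kernel of the $K$-algebra homomorphism $T_{\mathcal B}\to K[x_1,\dots,x_n]$, $z_w\mapsto w$. A symmetric exchange binomial of $\mathcal B$ is a binomial $z_uz_v-z_{u'}z_{v'}$ with $u=x_1^{a_1}\cdots x_n^{a_n}$ and $v=x_1^{b_1}\cdots x_n^{b_n}$ in $\mathcal B$ such that, for some $\xi,\rho$ with $a_\xi>b_\xi$ and $a_\rho<b_\rho$, both $u'=x_\rho(u/x_\xi)$ and $v'=x_\xi(v/x_\rho)$ belong to $\mathcal B$. Let $s\ge 1$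 and let $\mathcal B_1,\dots,\mathcal B_s$ be polymatroids in $K[x_1,\dots,x_n]$ with $J_{\mathcal B_i}=(0)$ for every $i$. Then the toric ideal of the product $\prod_{i=1}^s\mathcal B_i=\{u_1\cdots u_s : u_i\in\mathcal B_i\}$ is generated by the symmetric exchange binomials of $\prod_{i=1}^s\mathcal B_i$. In particular, if $d\ge 1$, $A_1,\dots,A_d$ are nonempty subsets of $\{1,\dots,n\}$ (not necessarily distinct), and $\mathcal B=\{x_{i_1}\cdots x_{i_d} : i_k\in A_k \text{ for } 1\le k\le d\}$ is the associated transversal polymatroid, then $J_{\mathcal B}$ is generated by the symmetric exchange binomials of $\mathcal B$. -/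

import Mathlib

/-- A monomial `x_1^{a_1} ⋯ x_n^{a_n}` is represented by its exponent vector `a : Fin n →₀ ℕ`.
A finite set `B` of monomials is a polymatroid (the set of bases of a discrete polymatroid) if
all its members have the same degree and, whenever `u, v ∈ B` and `ξ` satisfy
`u ξ > v ξ`, there is `ρ` with `u ρ < v ρ` such that `x_ρ (u / x_ξ) ∈ B`; the monomial
`w = x_ρ (u / x_ξ)` is described by `x_ξ w = x_ρ u`. -/
def IsPolymatroid {n : ℕ} (B : Finset (Fin n →₀ ℕ)) : Prop :=
  (∀ u ∈ B, ∀ v ∈ B, u.degree = v.degree) ∧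
    ∀ u ∈ B, ∀ v ∈ B, ∀ ξ : Fin n, v ξ < u ξ →
      ∃ ρ : Fin n, u ρ < v ρ ∧
        ∃ w ∈ B, w + Finsupp.single ξ 1 = u + Finsupp.single ρ 1

/-- The homomorphism `π_B : K[z_w : w ∈ B] → K[x_1, …, x_n]`, `z_w ↦ w`; its image is the base
ring `K[B]`. -/
noncomputable def toricMap (K : Type*) [Field K] {n : ℕ} (B : Finset (Fin n →₀ ℕ)) :
    MvPolynomial {w // w ∈ B} K →ₐ[K] MvPolynomial (Fin n) K :=
  MvPolynomial.aeval fun w => MvPolynomial.monomial w.1 (1 : K)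

/-- The toric ideal `J_B`, the kernel of `π_B`. -/
noncomputable def toricIdeal (K : Type*) [Field K] {n : ℕ} (B : Finset (Fin n →₀ ℕ)) :
    Ideal (MvPolynomial {w // w ∈ B} K) :=
  RingHom.ker (toricMap K B)

/-- The symmetric exchange binomials `z_u z_v - z_{u'} z_{v'}` of `B`, where `u, v ∈ B`,
`u ξ > v ξ`, `u ρ < v ρ`, and `u' = x_ρ (u / x_ξ)`, `v' = x_ξ (v / x_ρ)` both lie in `B`. -/
def symmetricExchangeBinomials (K : Type*) [Field K] {n : ℕ} (B : Finset (Fin n →₀ ℕ)) :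
    Set (MvPolynomial {w // w ∈ B} K) :=
  {f | ∃ (u v u' v' : {w // w ∈ B}) (ξ ρ : Fin n),
    v.1 ξ < u.1 ξ ∧ u.1 ρ < v.1 ρ ∧
    u'.1 + Finsupp.single ξ 1 = u.1 + Finsupp.single ρ 1 ∧
    v'.1 + Finsupp.single ρ 1 = v.1 + Finsupp.single ξ 1 ∧
    f = MvPolynomial.X u * MvPolynomial.X v - MvPolynomial.X u' * MvPolynomial.X v'}

/-- The product `{u_1 ⋯ u_s : u_i ∈ B_i}` of sets of monomials (exponent vectors add up). -/
noncomputable def polymatroidProduct {n s : ℕ} (B : Fin s → Finset (Fin n →₀ ℕ)) : Finset (Fin n →₀ ℕ) :=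
  (Fintype.piFinset B).image fun u => ∑ i, u i

/-- `B` is a transversal polymatroid: for some family `A_1, …, A_d`, `d ≥ 1`, of nonempty (not
necessarily distinct) subsets of `{1, …, n}`, it is the set of all monomials
`x_{i_1} ⋯ x_{i_d}` with `i_k ∈ A_k` for every `k`. -/
def IsTransversalPolymatroid {n : ℕ} (B : Finset (Fin n →₀ ℕ)) : Prop :=
  ∃ (d : ℕ) (A : Fin d → Finset (Fin n)), 0 < d ∧ (∀ k, (A k).Nonempty) ∧
    ∀ w : Fin n →₀ ℕ, w ∈ B ↔
      ∃ i : Fin d → Fin n, (∀ k, i k ∈ A k) ∧ w = ∑ k, Finsupp.single (i k) 1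

/-! If $J_{\mathcal B_i}=0$, any two members of $\mathcal B_i$ differ by one trade of variables
(`IsPolymatroid.exists_single_exchange`). Hence two members $u=\prod u_i$, $v=\prod v_i$ of the
product are joined by trades, one per factor, that can be performed independently: the product is
strongly orderable. A transversal polymatroid is a product of sets of variables, where single trades
are immediate.

For a strongly orderable set the toric ideal is handled by connecting fibres: two families with the
same sum must have the same product modulo symmetric exchanges (`IsStronglyOrderable.prod_eq_prod`).
If they differ, there are positions $i,j$ where the differences of the families have opposite signs
at some variable. The trades joining $u_i$ to $u_j$ and those joining $w_i$ to $w_j$ form the edges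
of one multigraph on the variables. A balanced orientation (`exists_balanced_signs`) selects which
trades to perform, redistributing $u_iu_j$ and $w_iw_j$ so that the two families become strictly
closer (`IsStronglyOrderable.exists_closer`). Since a toric ideal is spanned by differences of
monomials in a common fibre, the symmetric exchange binomials generate it. -/

/-! ### Balanced orientations of multigraphs -/

/-- The edges of a finite multigraph can be oriented so that indegree and outdegree differ by at
most one at every vertex. -/
theorem exists_balanced_signs {E X : Type*} [DecidableEq E] [DecidableEq X] (S : Finset E)
    (p q : E → X) :
    ∃ ε : E → ℤ, (∀ e, ε e = 1 ∨ ε e = -1) ∧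
      ∀ x, |∑ e ∈ S, ε e * ((if p e = x then 1 else 0) - (if q e = x then 1 else 0))| ≤ 1 := by
  induction hc : S.card generalizing S p q with
  | zero =>
    refine ⟨fun _ => 1, fun _ => Or.inl rfl, fun x => ?_⟩
    rw [Finset.card_eq_zero.1 hc]; simp
  | succ c ih =>
    -- Two edges meeting at a vertex are fused into one edge between their other ends. Directing the
    -- path through that vertex contributes zero there, so an orientation of the smaller graph lifts
    -- with the same imbalances; `τ` records whether `e'` is traversed backwards.
    have merge : ∀ e ∈ S, ∀ e' ∈ S, e ≠ e' → ∀ (p' q' : X) (τ : ℤ), (τ = 1 ∨ τ = -1) →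
        (∀ x, ((if p e = x then 1 else 0) - (if q e = x then 1 else 0) : ℤ) +
          τ * ((if p e' = x then 1 else 0) - (if q e' = x then 1 else 0)) =
          (if p' = x then 1 else 0) - (if q' = x then 1 else 0)) →
        ∃ ε : E → ℤ, (∀ e, ε e = 1 ∨ ε e = -1) ∧
          ∀ x, |∑ e ∈ S, ε e * ((if p e = x then 1 else 0) - (if q e = x then 1 else 0))| ≤ 1 := by
      intro e he e' he' hne p' q' τ hτ h
      obtain ⟨ε, hε, hb⟩ := ih (S.erase e') (Function.update p e p') (Function.update q e q')
        (by rw [Finset.card_erase_of_mem he', hc]; rfl)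
      refine ⟨Function.update ε e' (τ * ε e), fun k => ?_, fun x => ?_⟩
      · rcases eq_or_ne k e' with rfl | hk
        · rw [Function.update_self]
          rcases hτ with rfl | rfl <;> rcases hε e with h1 | h1 <;> simp [h1]
        · rw [Function.update_of_ne hk]; exact hε k
      · have he2 : e ∈ S.erase e' := Finset.mem_erase.2 ⟨hne, he⟩
        have hx := hb x
        rw [← Finset.add_sum_erase _ _ he2, Function.update_self, Function.update_self] at hx
        rw [← Finset.add_sum_erase _ _ he', ← Finset.add_sum_erase _ _ he2,
          Function.update_self, Function.update_of_ne hne]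
        have hs : ∑ k ∈ (S.erase e').erase e, Function.update ε e' (τ * ε e) k *
              ((if p k = x then 1 else 0) - (if q k = x then 1 else 0)) =
            ∑ k ∈ (S.erase e').erase e, ε k *
              ((if Function.update p e p' k = x then 1 else 0) -
                (if Function.update q e q' k = x then 1 else 0)) := by
          refine Finset.sum_congr rfl fun k hk => ?_
          rw [Finset.mem_erase, Finset.mem_erase] at hk
          rw [Function.update_of_ne hk.1, Function.update_of_ne hk.1,
            Function.update_of_ne hk.2.1]
        rw [hs]
        convert hx using 2
        rw [← h x]; ring
    by_cases hshare : ∃ e ∈ S, ∃ e' ∈ S, e ≠ e' ∧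
        (q e = p e' ∨ p e = p e' ∨ q e = q e')
    · obtain ⟨e, he, e', he', hne, h | h | h⟩ := hshare
      · exact merge e he e' he' hne (p e) (q e') 1 (Or.inl rfl) fun x => by rw [h]; ring
      · exact merge e he e' he' hne (q e') (q e) (-1) (Or.inr rfl) fun x => by rw [h]; ring
      · exact merge e he e' he' hne (p e) (p e') (-1) (Or.inr rfl) fun x => by rw [h]; ring
    -- Now distinct edges have no common endpoint, so each vertex meets at most one edge, and a loop
    -- contributes zero.
    · push Not at hshare
      refine ⟨fun _ => 1, fun _ => Or.inl rfl, fun x => ?_⟩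
      by_cases hx : ∃ e ∈ S, p e = x ∨ q e = x
      · obtain ⟨e, he, hex⟩ := hx
        rw [Finset.sum_eq_single_of_mem e he]
        · split_ifs <;> simp
        · intro k hk hke
          have h1 := hshare e he k hk hke.symm
          have h2 := hshare k hk e he hke
          have hp : p k ≠ x := by
            rintro rfl
            rcases hex with h | h
            · exact h1.2.1 h
            · exact h1.1 h
          have hq : q k ≠ x := by
            rintro rfl
            rcases hex with h | h
            · exact h2.1 h.symm
            · exact h1.2.2 h
          simp [hp, hq]
      · push Not at hx
        rw [Finset.sum_eq_zero]
        · simp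
        · intro e he
          simp [hx e he]

/-! ### Exchange systems and strong orderability -/

/-- A simultaneous exchange system of `B` starting at `u`: every partial exchange `u_I`,
`I ⊆ S`, obtained from `u` by trading `x_{a k}` for `x_{b k}` for `k ∈ I`, lies in `B`. -/
def IsExchangeSystem {E : Type*} {n : ℕ} (B : Finset (Fin n →₀ ℕ)) (u : Fin n →₀ ℕ)
    (S : Finset E) (a b : E → Fin n) : Prop :=
  ∀ I ⊆ S, ∃ w ∈ B,
    w + ∑ k ∈ I, Finsupp.single (a k) 1 = u + ∑ k ∈ I, Finsupp.single (b k) 1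

/-- The polymatroid analogue of strong base orderability. -/
def IsStronglyOrderable (E : Type*) {n : ℕ} (B : Finset (Fin n →₀ ℕ)) : Prop :=
  ∀ u ∈ B, ∀ v ∈ B, ∃ (S : Finset E) (a b : E → Fin n), IsExchangeSystem B u S a b ∧
    v + ∑ k ∈ S, Finsupp.single (a k) 1 = u + ∑ k ∈ S, Finsupp.single (b k) 1 ∧
    ∀ k ∈ S, ∀ l ∈ S, a k ≠ b l

/-- A variable both given up and received can be cancelled: a trade of a variable for itself is
dropped, and two trades passing through a common variable are fused. Each cancellation shortens the
system. -/
theorem IsExchangeSystem.exists_disjoint {E : Type*} [DecidableEq E] {n : ℕ}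
    {B : Finset (Fin n →₀ ℕ)} {u v : Fin n →₀ ℕ} {S : Finset E} {a b : E → Fin n}
    (h : IsExchangeSystem B u S a b)
    (hv : v + ∑ k ∈ S, Finsupp.single (a k) 1 = u + ∑ k ∈ S, Finsupp.single (b k) 1) :
    ∃ (S : Finset E) (a b : E → Fin n), IsExchangeSystem B u S a b ∧
      v + ∑ k ∈ S, Finsupp.single (a k) 1 = u + ∑ k ∈ S, Finsupp.single (b k) 1 ∧
      ∀ k ∈ S, ∀ l ∈ S, a k ≠ b l := by
  induction hc : S.card using Nat.strong_induction_on generalizing S a b with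
  | _ c ih =>
    by_cases hd : ∀ k ∈ S, ∀ l ∈ S, a k ≠ b l
    · exact ⟨S, a, b, h, hv, hd⟩
    push Not at hd
    obtain ⟨l, hl, k, hk, hlk⟩ := hd
    have hlt : (S.erase l).card < c := hc ▸ Finset.card_erase_lt_of_mem hl
    rcases eq_or_ne k l with rfl | hne
    · refine ih _ hlt (S := S.erase k) (a := a) (b := b)
        (fun I hI => h I (hI.trans (Finset.erase_subset _ _))) ?_ rfl
      rw [← Finset.add_sum_erase _ _ hl, ← Finset.add_sum_erase _ _ hl, hlk] at hv
      rw [← add_right_inj (Finsupp.single (b k) 1)]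
      rw [add_left_comm, hv, add_left_comm]
    · -- `b k = a l`: fuse the two exchanges into one.
      have key : ∀ I ⊆ S.erase l, ∀ w : Fin n →₀ ℕ,
          (w + ∑ j ∈ (if k ∈ I then insert l I else I), Finsupp.single (a j) 1 =
            u + ∑ j ∈ (if k ∈ I then insert l I else I), Finsupp.single (b j) 1) →
          w + ∑ j ∈ I, Finsupp.single (a j) 1 =
            u + ∑ j ∈ I, Finsupp.single (Function.update b k (b l) j) 1 := by
        intro I hI w hw
        have hlI : l ∉ I := fun hh => (Finset.mem_erase.1 (hI hh)).1 rfl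
        split_ifs at hw with hkI
        · rw [Finset.sum_insert hlI, Finset.sum_insert hlI,
            ← Finset.add_sum_erase I (fun j => Finsupp.single (b j) 1) hkI] at hw
          rw [← Finset.add_sum_erase I (fun j => Finsupp.single (Function.update b k (b l) j) 1)
            hkI, Function.update_self]
          have hs : ∑ j ∈ I.erase k, Finsupp.single (Function.update b k (b l) j) (1 : ℕ) =
              ∑ j ∈ I.erase k, Finsupp.single (b j) 1 :=
            Finset.sum_congr rfl fun j hj => by
              rw [Function.update_of_ne (Finset.ne_of_mem_erase hj)]
          rw [hs, ← add_right_inj (Finsupp.single (b k) 1)]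
          calc _ = w + (Finsupp.single (a l) 1 + ∑ j ∈ I, Finsupp.single (a j) 1) := by
                rw [hlk]; abel
            _ = _ := by rw [hw]; abel
        · rw [hw]
          congr 1
          refine Finset.sum_congr rfl fun j hj => ?_
          rw [Function.update_of_ne]
          rintro rfl; exact hkI hj
      refine ih _ hlt (S := S.erase l) (a := a) (b := Function.update b k (b l)) ?_ ?_ rfl
      · intro I hI
        have hsub : (if k ∈ I then insert l I else I) ⊆ S := by
          have := hI.trans (Finset.erase_subset _ _)
          split_ifs
          · exact Finset.insert_subset hl this
          · exact this
        obtain ⟨w, hw, hw'⟩ := h _ hsub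
        exact ⟨w, hw, key I hI w hw'⟩
      · refine key _ subset_rfl v ?_
        rw [if_pos (Finset.mem_erase.2 ⟨hne, hk⟩), Finset.insert_erase hl]
        exact hv

theorem IsExchangeSystem.exists_of_mem {E : Type*} [DecidableEq E] {n : ℕ}
    {B : Finset (Fin n →₀ ℕ)} {u : Fin n →₀ ℕ} {S : Finset E} {a b : E → Fin n}
    (h : IsExchangeSystem B u S a b) {k : E} (hk : k ∈ S) :
    ∃ w ∈ B, w + Finsupp.single (a k) 1 = u + Finsupp.single (b k) 1 := by
  obtain ⟨w, hw, hw'⟩ := h {k} (Finset.singleton_subset_iff.2 hk)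
  exact ⟨w, hw, by simpa using hw'⟩

/-- Some trade `k` of a system from `u` to `v` must bring in `ρ`. Performing only `k`, and all
trades except `k`, gives the two new elements; disjointness makes the variable given up by `k`
strictly decrease from `u` to `v`. -/
theorem IsStronglyOrderable.exists_symmetric_exchange {E : Type*} [DecidableEq E] {n : ℕ}
    {B : Finset (Fin n →₀ ℕ)} (hB : IsStronglyOrderable E B) {u v : Fin n →₀ ℕ} (hu : u ∈ B)
    (hv : v ∈ B) {ρ : Fin n} (hρ : u ρ < v ρ) :
    ∃ ξ, v ξ < u ξ ∧ ∃ u' ∈ B, ∃ v' ∈ B,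
      u' + Finsupp.single ξ 1 = u + Finsupp.single ρ 1 ∧
      v' + Finsupp.single ρ 1 = v + Finsupp.single ξ 1 := by
  obtain ⟨S, a, b, hS, hend, hd⟩ := hB u hu v hv
  have hcoord : ∀ x, v x + ∑ k ∈ S, (if a k = x then 1 else 0) =
      u x + ∑ k ∈ S, (if b k = x then 1 else 0) := by
    intro x
    have := DFunLike.congr_fun hend x
    simpa [Finsupp.finsetSum_apply, Finsupp.single_apply] using this
  obtain ⟨k, hk, hbk⟩ : ∃ k ∈ S, b k = ρ := by
    by_contra! hcon
    have h1 := hcoord ρ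
    rw [Finset.sum_eq_zero (s := S) (f := fun k => if b k = ρ then 1 else 0)
      fun k hk => by simp [hcon k hk]] at h1
    omega
  have hxi : v (a k) < u (a k) := by
    have h1 := hcoord (a k)
    rw [Finset.sum_eq_zero (s := S) (f := fun j => if b j = a k then 1 else 0)
      fun j hj => by simp [(hd k hk j hj).symm]] at h1
    have h2 : 1 ≤ ∑ j ∈ S, (if a j = a k then 1 else 0) := by
      have := Finset.single_le_sum (f := fun j => if a j = a k then 1 else 0)
        (fun _ _ => Nat.zero_le _) hk
      simpa using this
    omega
  obtain ⟨u', hu', hu''⟩ := hS.exists_of_mem hk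
  obtain ⟨v', hv', hv''⟩ := hS (S.erase k) (Finset.erase_subset _ _)
  refine ⟨a k, hxi, u', hu', v', hv', hbk ▸ hu'', ?_⟩
  rw [← Finset.add_sum_erase _ _ hk, ← Finset.add_sum_erase _ _ hk] at hend
  rw [← hbk, ← add_left_inj (∑ j ∈ S.erase k, Finsupp.single (a j) 1)]
  calc _ = v' + ∑ j ∈ S.erase k, Finsupp.single (a j) 1 + Finsupp.single (b k) 1 := by abel
    _ = u + (Finsupp.single (b k) 1 + ∑ j ∈ S.erase k, Finsupp.single (b j) 1) := by
      rw [hv'']; abel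
    _ = _ := by rw [← hend]; abel

/-! ### Products invariant under symmetric exchange -/

/-- `g` is compatible with the symmetric exchanges of `B`. -/
def RespectsSymmetricExchange {M : Type*} [CommMonoid M] {n : ℕ} (B : Finset (Fin n →₀ ℕ))
    (g : (Fin n →₀ ℕ) → M) : Prop :=
  ∀ u ∈ B, ∀ v ∈ B, ∀ u' ∈ B, ∀ v' ∈ B, ∀ ξ ρ : Fin n, v ξ < u ξ → u ρ < v ρ →
    u' + Finsupp.single ξ 1 = u + Finsupp.single ρ 1 →
    v' + Finsupp.single ρ 1 = v + Finsupp.single ξ 1 → g u * g v = g u' * g v'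

theorem apply_of_add_single_eq {n : ℕ} {u u' : Fin n →₀ ℕ} {ξ ρ : Fin n}
    (h : u' + Finsupp.single ξ 1 = u + Finsupp.single ρ 1) (x : Fin n) :
    u' x + (if ξ = x then 1 else 0) = u x + (if ρ = x then 1 else 0) := by
  have := DFunLike.congr_fun h x
  simpa [Finsupp.single_apply] using this

section Exchange

variable {E M : Type*} [DecidableEq E] [CommMonoid M] {n : ℕ} {B : Finset (Fin n →₀ ℕ)}
  {g : (Fin n →₀ ℕ) → M}

/-- The exchange of `ξ` for `ρ` may not be strict, but it factors through a third pair: a strict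
exchange of some `τ` for `ρ` leads from `(u, v)` to `(u₁, v₁)`, and a strict exchange of `τ` for `ξ`
leads there from `(u', v')`. -/
theorem RespectsSymmetricExchange.mul_eq_of_le (hg : RespectsSymmetricExchange B g)
    (hB : IsStronglyOrderable E B) {u v u' v' : Fin n →₀ ℕ} (hu : u ∈ B) (hv : v ∈ B)
    (hu' : u' ∈ B) (hv' : v' ∈ B) {ξ ρ : Fin n}
    (h1 : u' + Finsupp.single ξ 1 = u + Finsupp.single ρ 1)
    (h2 : v' + Finsupp.single ρ 1 = v + Finsupp.single ξ 1)
    (hne : ξ ≠ ρ) (hξ : u ξ ≤ v ξ) (hρ : u ρ < v ρ) : g u * g v = g u' * g v' := by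
  obtain ⟨τ, hτ, u₁, hu₁, v₁, hv₁, e1, e2⟩ := hB.exists_symmetric_exchange hu hv hρ
  have hτξ : τ ≠ ξ := by rintro rfl; omega
  have hτρ : τ ≠ ρ := by rintro rfl; omega
  rw [hg u hu v hv u₁ hu₁ v₁ hv₁ τ ρ hτ hρ e1 e2]
  refine (hg u' hu' v' hv' u₁ hu₁ v₁ hv₁ τ ξ ?_ ?_ (e1.trans h1.symm) ?_).symm
  · have a1 := apply_of_add_single_eq h1 τ
    have a2 := apply_of_add_single_eq h2 τ
    simp only [hτξ.symm, hτρ.symm, if_false] at a1 a2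
    omega
  · have a1 := apply_of_add_single_eq h1 ξ
    have a2 := apply_of_add_single_eq h2 ξ
    simp only [hne.symm, if_false, if_true] at a1 a2
    omega
  · rw [← add_left_inj (Finsupp.single ρ 1), add_right_comm, e2, add_right_comm, ← h2]
    abel

/-- The strictness conditions in the definition of a symmetric exchange can be dropped. -/
theorem RespectsSymmetricExchange.mul_eq (hg : RespectsSymmetricExchange B g)
    (hB : IsStronglyOrderable E B) {u v u' v' : Fin n →₀ ℕ} (hu : u ∈ B) (hv : v ∈ B)
    (hu' : u' ∈ B) (hv' : v' ∈ B) {ξ ρ : Fin n}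
    (h1 : u' + Finsupp.single ξ 1 = u + Finsupp.single ρ 1)
    (h2 : v' + Finsupp.single ρ 1 = v + Finsupp.single ξ 1) : g u * g v = g u' * g v' := by
  rcases eq_or_ne ξ ρ with rfl | hne
  · rw [add_right_cancel h1, add_right_cancel h2]
  by_cases hs : v ξ < u ξ ∧ u ρ < v ρ
  · exact hg u hu v hv u' hu' v' hv' ξ ρ hs.1 hs.2 h1 h2
  -- This is exactly the condition for the reverse exchange, from the primed pair back, to be
  -- strict.
  by_cases ht : u ξ < v ξ + 2 ∧ v ρ < u ρ + 2
  · have a1 := apply_of_add_single_eq h1 ξ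
    have a2 := apply_of_add_single_eq h2 ξ
    have a3 := apply_of_add_single_eq h1 ρ
    have a4 := apply_of_add_single_eq h2 ρ
    simp only [hne, hne.symm, if_false, if_true] at a1 a2 a3 a4
    rw [mul_comm (g u'), mul_comm (g u)]
    exact (hg v' hv' u' hu' v hv u hu ξ ρ (by omega) (by omega) h2.symm h1.symm).symm
  by_cases hA : u ξ ≤ v ξ ∧ u ρ < v ρ
  · exact hg.mul_eq_of_le hB hu hv hu' hv' h1 h2 hne hA.1 hA.2
  -- The remaining case has `v ρ ≤ u ρ` and `v ξ < u ξ`, the previous one with `u`, `v` and `ξ`, `ρ`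
  -- interchanged.
  · rw [mul_comm (g u'), mul_comm (g u)]
    exact hg.mul_eq_of_le hB hv hu hv' hu' h2 h1 hne.symm (by omega) (by omega)

/-- Two complementary partial exchanges have the same product as the endpoints. -/
theorem IsExchangeSystem.exists_split (hg : RespectsSymmetricExchange B g)
    (hB : IsStronglyOrderable E B) {u v : Fin n →₀ ℕ} (hu : u ∈ B) (hv : v ∈ B) {S : Finset E}
    {a b : E → Fin n} (h : IsExchangeSystem B u S a b)
    (hend : v + ∑ k ∈ S, Finsupp.single (a k) 1 = u + ∑ k ∈ S, Finsupp.single (b k) 1)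
    (I : Finset E) (hI : I ⊆ S) :
    ∃ w ∈ B, ∃ w' ∈ B,
      w + ∑ k ∈ I, Finsupp.single (a k) 1 = u + ∑ k ∈ I, Finsupp.single (b k) 1 ∧
      w' + ∑ k ∈ S \ I, Finsupp.single (a k) 1 = u + ∑ k ∈ S \ I, Finsupp.single (b k) 1 ∧
      g u * g v = g w * g w' := by
  induction I using Finset.induction_on with
  | empty => exact ⟨u, hu, v, hv, by simp, by simpa using hend, rfl⟩
  | insert k I hk ih =>
    obtain ⟨w, hw, w', hw', e1, e2, e3⟩ := ih ((Finset.subset_insert _ _).trans hI)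
    have hkS : k ∈ S \ I := Finset.mem_sdiff.2 ⟨hI (Finset.mem_insert_self _ _), hk⟩
    obtain ⟨y, hy, d1⟩ := h _ hI
    obtain ⟨y', hy', d2⟩ := h (S \ insert k I) Finset.sdiff_subset
    refine ⟨y, hy, y', hy', d1, d2, e3.trans ?_⟩
    -- Moving `k` from the complement into `I` is a symmetric exchange that need not be strict.
    refine hg.mul_eq hB hw hw' hy hy' (ξ := a k) (ρ := b k) ?_ ?_
    · rw [Finset.sum_insert hk, Finset.sum_insert hk] at d1
      rw [← add_left_inj (∑ k ∈ I, Finsupp.single (a k) 1)]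
      calc _ = u + (Finsupp.single (b k) 1 + ∑ k ∈ I, Finsupp.single (b k) 1) := by
            rw [← d1]; abel
        _ = u + ∑ k ∈ I, Finsupp.single (b k) 1 + Finsupp.single (b k) 1 := by abel
        _ = _ := by rw [← e1]; abel
    · rw [← Finset.add_sum_erase _ _ hkS, ← Finset.add_sum_erase _ _ hkS,
        ← Finset.sdiff_insert] at e2
      rw [← add_left_inj (∑ j ∈ S \ insert k I, Finsupp.single (a j) 1)]
      calc _ = u + (Finsupp.single (b k) 1 + ∑ j ∈ S \ insert k I, Finsupp.single (b j) 1) := by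
            rw [add_right_comm, d2]; abel
        _ = _ := by rw [← e2]; abel

/-! ### Connecting families with the same sum -/

/-- The distance between two exponent vectors. -/
def expDist {n : ℕ} (u v : Fin n →₀ ℕ) : ℕ := ∑ x, ((u x : ℤ) - v x).natAbs

theorem cast_apply_of_add_sum_eq {E : Type*} {n : ℕ} {u w : Fin n →₀ ℕ} {I : Finset E} {a b : E → Fin n}
    (h : w + ∑ k ∈ I, Finsupp.single (a k) 1 = u + ∑ k ∈ I, Finsupp.single (b k) 1) (x : Fin n) :
    (w x : ℤ) = u x - ∑ k ∈ I, ((if a k = x then 1 else 0) - (if b k = x then 1 else 0)) := by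
  have := DFunLike.congr_fun h x
  simp only [Finsupp.add_apply, Finsupp.finsetSum_apply, Finsupp.single_apply] at this
  have h2 := congrArg (Nat.cast : ℕ → ℤ) this
  push_cast at h2
  rw [Finset.sum_sub_distrib]
  linarith

theorem sum_sign_mul {S : Finset E} {ε : E → ℤ} (hε : ∀ e, ε e = 1 ∨ ε e = -1) (f : E → ℤ) :
    ∑ k ∈ S, ε k * f k = ∑ k ∈ S \ S.filter (fun k => ε k = -1), f k - ∑ k ∈ S.filter (fun k => ε k = -1), f k := by
  rw [← Finset.sum_sdiff (Finset.filter_subset (fun k => ε k = -1) S), sub_eq_add_neg,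
    ← Finset.sum_neg_distrib]
  congr 1
  · refine Finset.sum_congr rfl fun k hk => ?_
    simp only [Finset.mem_sdiff, Finset.mem_filter, not_and] at hk
    rw [(hε k).resolve_right (hk.2 hk.1), one_mul]
  · refine Finset.sum_congr rfl fun k hk => ?_
    rw [(Finset.mem_filter.1 hk).2, neg_one_mul]

/-- Two pairs of elements of `B` can be moved towards each other by symmetric exchanges. -/
theorem IsStronglyOrderable.exists_closer (hg : RespectsSymmetricExchange B g)
    (hB : IsStronglyOrderable E B) {u₁ u₂ w₁ w₂ : Fin n →₀ ℕ} (hu₁ : u₁ ∈ B) (hu₂ : u₂ ∈ B)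
    (hw₁ : w₁ ∈ B) (hw₂ : w₂ ∈ B) {x : Fin n} (hx₁ : w₁ x < u₁ x) (hx₂ : u₂ x < w₂ x) :
    ∃ u₁' ∈ B, ∃ u₂' ∈ B, ∃ w₁' ∈ B, ∃ w₂' ∈ B,
      g u₁ * g u₂ = g u₁' * g u₂' ∧ g w₁ * g w₂ = g w₁' * g w₂' ∧
      u₁' + u₂' = u₁ + u₂ ∧ w₁' + w₂' = w₁ + w₂ ∧
      expDist u₁' w₁' + expDist u₂' w₂' < expDist u₁ w₁ + expDist u₂ w₂ := by
  obtain ⟨S, a, b, hS, hSe, -⟩ := hB u₁ hu₁ u₂ hu₂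
  obtain ⟨T, c, d, hT, hTe, -⟩ := hB w₁ hw₁ w₂ hw₂
  -- The edges from `T` are reversed, so that the signed sum at a vertex is the difference of the
  -- two gaps, `(y₁ - y₂) - (z₁ - z₂)`.
  obtain ⟨ε, hε, hbal⟩ := exists_balanced_signs (S.disjSum T) (Sum.elim a d) (Sum.elim b c)
  have hl := fun e => hε (Sum.inl e)
  have hr := fun e => hε (Sum.inr e)
  obtain ⟨y₁, hy₁, y₂, hy₂, p1, p2, p3⟩ := hS.exists_split hg hB hu₁ hu₂ hSe
    (S.filter (fun k => ε (Sum.inl k) = -1)) (Finset.filter_subset _ _)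
  obtain ⟨z₁, hz₁, z₂, hz₂, q1, q2, q3⟩ := hT.exists_split hg hB hw₁ hw₂ hTe
    (T.filter (fun k => ε (Sum.inr k) = -1)) (Finset.filter_subset _ _)
  have hys : ∀ x, (y₁ x : ℤ) + y₂ x = u₁ x + u₂ x := fun x => by
    rw [cast_apply_of_add_sum_eq p1, cast_apply_of_add_sum_eq p2, cast_apply_of_add_sum_eq hSe,
      ← Finset.sum_sdiff (Finset.filter_subset (fun k => ε (Sum.inl k) = -1) S)]
    ring
  have hzs : ∀ x, (z₁ x : ℤ) + z₂ x = w₁ x + w₂ x := fun x => by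
    rw [cast_apply_of_add_sum_eq q1, cast_apply_of_add_sum_eq q2, cast_apply_of_add_sum_eq hTe,
      ← Finset.sum_sdiff (Finset.filter_subset (fun k => ε (Sum.inr k) = -1) T)]
    ring
  have hb : ∀ x, |((y₁ x : ℤ) - y₂ x) - (z₁ x - z₂ x)| ≤ 1 := fun x => by
    have h : |∑ k ∈ S, ε (Sum.inl k) * ((if a k = x then 1 else 0) - (if b k = x then 1 else 0)) +
        ∑ k ∈ T, ε (Sum.inr k) * ((if d k = x then 1 else 0) - (if c k = x then 1 else 0))| ≤ 1 := by
      have := hbal x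
      rw [Finset.sum_disjSum] at this
      exact this
    convert h using 2
    rw [sum_sign_mul hl, sum_sign_mul hr, cast_apply_of_add_sum_eq p1,
      cast_apply_of_add_sum_eq p2, cast_apply_of_add_sum_eq q1, cast_apply_of_add_sum_eq q2]
    simp only [Finset.sum_sub_distrib]
    ring
  -- The integers `y₁ x - z₁ x` and `y₂ x - z₂ x` differ by at most one, so they do not have
  -- opposite signs, and their absolute values add up to that of their sum. This sum equals `(u₁ x -
  -- w₁ x) + (u₂ x - w₂ x)`; the triangle inequality is strict where these two terms have opposite
  -- signs, as at the given `x`.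
  have hle : ∀ x, ((y₁ x : ℤ) - z₁ x).natAbs + ((y₂ x : ℤ) - z₂ x).natAbs ≤
      ((u₁ x : ℤ) - w₁ x).natAbs + ((u₂ x : ℤ) - w₂ x).natAbs := fun x => by
    have h1 := hys x
    have h2 := hzs x
    have h3 := abs_le.1 (hb x)
    omega
  refine ⟨y₁, hy₁, y₂, hy₂, z₁, hz₁, z₂, hz₂, p3, q3, ?_, ?_, ?_⟩
  · ext x; have := hys x; simp only [Finsupp.add_apply]; omega
  · ext x; have := hzs x; simp only [Finsupp.add_apply]; omega
  · simp only [expDist, ← Finset.sum_add_distrib]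
    refine Finset.sum_lt_sum (fun x _ => hle x) ⟨x, Finset.mem_univ x, ?_⟩
    have h1 := hys x
    have h2 := hzs x
    have h3 := abs_le.1 (hb x)
    omega

theorem mul_prod_update₂ {ι N : Type*} [Fintype ι] [DecidableEq ι] [CommMonoid N] {A : Type*}
    (G : A → N) (u : ι → A) {i j : ι} (hij : i ≠ j) (y z : A) :
    ∏ k, G (Function.update (Function.update u i y) j z k) =
      G y * G z * ∏ k ∈ (Finset.univ.erase i).erase j, G (u k) := by
  have hj : j ∈ Finset.univ.erase i := Finset.mem_erase.2 ⟨hij.symm, Finset.mem_univ _⟩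
  rw [← Finset.mul_prod_erase _ _ (Finset.mem_univ i), ← Finset.mul_prod_erase _ _ hj,
    Function.update_self, Function.update_of_ne hij, Function.update_self, mul_assoc]
  congr 2
  refine Finset.prod_congr rfl fun k hk => ?_
  rw [Finset.mem_erase, Finset.mem_erase] at hk
  rw [Function.update_of_ne hk.1, Function.update_of_ne hk.2.1]

theorem mul_prod_erase₂ {ι N : Type*} [Fintype ι] [DecidableEq ι] [CommMonoid N]
    (G : ι → N) {i j : ι} (hij : i ≠ j) :
    ∏ k, G k = G i * G j * ∏ k ∈ (Finset.univ.erase i).erase j, G k := by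
  have hj : j ∈ Finset.univ.erase i := Finset.mem_erase.2 ⟨hij.symm, Finset.mem_univ _⟩
  rw [← Finset.mul_prod_erase _ _ (Finset.mem_univ i), ← Finset.mul_prod_erase _ _ hj, mul_assoc]

/-- Families of elements of `B` with the same sum are connected by symmetric exchanges. -/
theorem IsStronglyOrderable.prod_eq_prod {ι : Type*} [Fintype ι] [DecidableEq ι]
    (hg : RespectsSymmetricExchange B g)
    (hB : IsStronglyOrderable E B) (u w : ι → Fin n →₀ ℕ) (hu : ∀ i, u i ∈ B)
    (hw : ∀ i, w i ∈ B) (hsum : ∑ i, u i = ∑ i, w i) : ∏ i, g (u i) = ∏ i, g (w i) := by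
  induction hD : ∑ i, expDist (u i) (w i) using Nat.strong_induction_on generalizing u w with
  | _ D ih =>
    by_cases heq : ∀ i x, u i x ≤ w i x
    · have : u = w := by
        funext i
        have := (Finset.sum_eq_sum_iff_of_le (s := Finset.univ) (f := u) (g := w)
          (fun i _ => fun x => heq i x)).1 hsum
        exact this i (Finset.mem_univ i)
      rw [this]
    push Not at heq
    obtain ⟨i, x, hix⟩ := heq
    have hsx : ∑ i, u i x = ∑ i, w i x := by
      simpa only [Finsupp.finsetSum_apply] using DFunLike.congr_fun hsum x
    obtain ⟨j, hjx⟩ : ∃ j, u j x < w j x := by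
      by_contra! hcon
      exact (Finset.sum_lt_sum (fun j _ => hcon j) ⟨i, Finset.mem_univ i, hix⟩).ne hsx.symm
    have hij : i ≠ j := by rintro rfl; omega
    obtain ⟨u₁, hu₁, u₂, hu₂, w₁, hw₁, w₂, hw₂, e1, e2, e3, e4, e5⟩ :=
      hB.exists_closer hg (hu i) (hu j) (hw i) (hw j) hix hjx
    have hmem : ∀ (u : ι → Fin n →₀ ℕ) (y z : Fin n →₀ ℕ), (∀ i, u i ∈ B) → y ∈ B → z ∈ B →
        ∀ k, Function.update (Function.update u i y) j z k ∈ B := by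
      intro u y z hu hy hz k
      rcases eq_or_ne k j with rfl | hk
      · rwa [Function.update_self]
      rw [Function.update_of_ne hk]
      rcases eq_or_ne k i with rfl | hk
      · rwa [Function.update_self]
      rw [Function.update_of_ne hk]
      exact hu k
    have hsum' : ∀ (u : ι → Fin n →₀ ℕ) (y z : Fin n →₀ ℕ), y + z = u i + u j →
        ∑ k, Function.update (Function.update u i y) j z k = ∑ k, u k := by
      intro u y z h
      have h1 := mul_prod_update₂ (N := Multiplicative (Fin n →₀ ℕ)) Multiplicative.ofAdd u hij y z
      have h2 := mul_prod_erase₂ (N := Multiplicative (Fin n →₀ ℕ))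
        (fun k => Multiplicative.ofAdd (u k)) hij
      rw [← ofAdd_add, h, ofAdd_add, ← h2] at h1
      exact h1
    have hprod : ∀ (u : ι → Fin n →₀ ℕ) (y z : Fin n →₀ ℕ), g (u i) * g (u j) = g y * g z →
        ∏ k, g (u k) = ∏ k, g (Function.update (Function.update u i y) j z k) := by
      intro u y z h
      rw [mul_prod_update₂ g u hij, mul_prod_erase₂ (fun k => g (u k)) hij, h]
    rw [hprod u _ _ e1, hprod w _ _ e2]
    refine ih _ ?_ _ _ (hmem u _ _ hu hu₁ hu₂) (hmem w _ _ hw hw₁ hw₂) ?_ rfl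
    · have hj : j ∈ Finset.univ.erase i := Finset.mem_erase.2 ⟨hij.symm, Finset.mem_univ _⟩
      rw [← hD]
      rw [← Finset.add_sum_erase _ _ (Finset.mem_univ i), ← Finset.add_sum_erase _ _ hj,
        ← Finset.add_sum_erase Finset.univ (fun i => expDist (u i) (w i)) (Finset.mem_univ i),
        ← Finset.add_sum_erase _ (fun i => expDist (u i) (w i)) hj,
        Function.update_self, Function.update_self,
        Function.update_of_ne hij, Function.update_self, Function.update_of_ne hij,
        Function.update_self]
      have : ∑ k ∈ (Finset.univ.erase i).erase j,
          expDist (Function.update (Function.update u i u₁) j u₂ k)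
            (Function.update (Function.update w i w₁) j w₂ k) =
          ∑ k ∈ (Finset.univ.erase i).erase j, expDist (u k) (w k) := by
        refine Finset.sum_congr rfl fun k hk => ?_
        rw [Finset.mem_erase, Finset.mem_erase] at hk
        simp only [Function.update_of_ne hk.1, Function.update_of_ne hk.2.1]
      rw [this]
      omega
    · rw [hsum' u _ _ e3, hsum' w _ _ e4, hsum]

end Exchange

/-! ### Toric ideals and binomials -/

section BinomialGenerators

variable {K : Type*} [Field K] {n : ℕ} {B : Finset (Fin n →₀ ℕ)}

/-- The exponent vector of the image of a monomial under `toricMap`. -/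
noncomputable def toricExponent (B : Finset (Fin n →₀ ℕ)) :
    ({w // w ∈ B} →₀ ℕ) →ₗ[ℕ] (Fin n →₀ ℕ) :=
  Finsupp.linearCombination ℕ Subtype.val

theorem toricMap_monomial (m : {w // w ∈ B} →₀ ℕ) (c : K) :
    toricMap K B (MvPolynomial.monomial m c) = MvPolynomial.monomial (toricExponent B m) c := by
  rw [toricMap, MvPolynomial.aeval_monomial, toricExponent, Finsupp.linearCombination_apply,
    MvPolynomial.monomial_finsupp_sum_index, MvPolynomial.algebraMap_eq]
  simp [MvPolynomial.monomial_pow]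

/-- Choose one monomial in each fibre of the exponent map and let `ψ` be the linear map sending an
image monomial to the chosen one. Then `f - ψ (toricMap K B f)` is a combination of fibre binomials,
and it equals `f` on the kernel. -/
theorem toricIdeal_le_of_binomials {I : Ideal (MvPolynomial {w // w ∈ B} K)}
    (h : ∀ m m', toricExponent B m = toricExponent B m' →
      MvPolynomial.monomial m (1 : K) - MvPolynomial.monomial m' 1 ∈ I) :
    toricIdeal K B ≤ I := by
  let ψ : MvPolynomial (Fin n) K →ₗ[K] MvPolynomial {w // w ∈ B} K :=
    (MvPolynomial.basisMonomials (Fin n) K).constr K fun e =>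
      MvPolynomial.monomial (Function.invFun (toricExponent B) e) 1
  have hψ : ∀ e, ψ (MvPolynomial.monomial e 1) =
      MvPolynomial.monomial (Function.invFun (toricExponent B) e) 1 := fun e => by
    have := (MvPolynomial.basisMonomials (Fin n) K).constr_basis K
      (fun e => MvPolynomial.monomial (Function.invFun (toricExponent B) e) (1 : K)) e
    rwa [MvPolynomial.coe_basisMonomials] at this
  have key : ∀ f, f - ψ (toricMap K B f) ∈ I := by
    intro f
    induction f using MvPolynomial.induction_on' with
    | monomial m c =>
      have hc : ∀ {σ : Type _} (e : σ →₀ ℕ), MvPolynomial.monomial e c =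
          c • MvPolynomial.monomial e (1 : K) := fun e => by
        rw [MvPolynomial.smul_monomial, smul_eq_mul, mul_one]
      rw [toricMap_monomial, hc, hc, map_smul, hψ, ← smul_sub, MvPolynomial.smul_eq_C_mul]
      refine I.mul_mem_left _ (h _ _ ?_)
      exact (Function.invFun_eq ⟨m, rfl⟩).symm
    | add p q hp hq =>
      rw [map_add, map_add, add_sub_add_comm]
      exact I.add_mem hp hq
  intro f hf
  have h0 : toricMap K B f = 0 := hf
  have := key f
  rwa [h0, map_zero, sub_zero] at this

theorem Finsupp.exists_eq_sum_single {σ : Type*} (k : ℕ) (m : σ →₀ ℕ) (h : m.degree = k) :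
    ∃ u : Fin k → σ, m = ∑ i, Finsupp.single (u i) 1 := by
  induction k generalizing m with
  | zero => exact ⟨Fin.elim0, by simpa using (Finsupp.degree_eq_zero_iff m).1 h⟩
  | succ k ih =>
    obtain ⟨x, hx⟩ : ∃ x, m x ≠ 0 := by
      by_contra! hcon
      rw [show m = 0 from Finsupp.ext hcon, map_zero] at h
      omega
    have hle : Finsupp.single x 1 ≤ m := by
      rw [Finsupp.single_le_iff]; omega
    have hm : Finsupp.single x 1 + (m - Finsupp.single x 1) = m := add_tsub_cancel_of_le hle
    obtain ⟨u, hu⟩ := ih (m - Finsupp.single x 1) (by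
      rw [← hm, map_add, Finsupp.degree_single] at h
      omega)
    refine ⟨Fin.cons x u, ?_⟩
    rw [Fin.sum_univ_succ]
    simp only [Fin.cons_zero, Fin.cons_succ]
    rw [← hu, hm]

theorem toricExponent_single (w : {w // w ∈ B}) :
    toricExponent B (Finsupp.single w 1) = w.1 := by
  simp [toricExponent]

theorem symmetricExchangeBinomials_subset :
    symmetricExchangeBinomials K B ⊆ toricIdeal K B := by
  rintro f ⟨u, v, u', v', ξ, ρ, -, -, h1, h2, rfl⟩
  change toricMap K B _ = 0
  have hX : ∀ w : {w // w ∈ B}, toricMap K B (MvPolynomial.X w) =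
      MvPolynomial.monomial w.1 1 := fun w => by simp [toricMap]
  have : u.1 + v.1 = u'.1 + v'.1 := by
    ext x
    have h3 := DFunLike.congr_fun h1 x
    have h4 := DFunLike.congr_fun h2 x
    simp only [Finsupp.add_apply] at h3 h4 ⊢
    omega
  rw [map_sub, map_mul, map_mul, hX, hX, hX, hX, MvPolynomial.monomial_mul,
    MvPolynomial.monomial_mul, this, sub_self]

/-- The toric ideal of a strongly orderable set of monomials of fixed positive degree is generated
by symmetric exchange binomials. -/
theorem IsStronglyOrderable.toricIdeal_eq_span {E : Type*} [DecidableEq E]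
    (hB : IsStronglyOrderable E B) {d : ℕ} (hd : 0 < d) (hdeg : ∀ u ∈ B, u.degree = d) :
    toricIdeal K B = Ideal.span (symmetricExchangeBinomials K B) := by
  refine le_antisymm (toricIdeal_le_of_binomials fun m m' hmm => ?_)
    (Ideal.span_le.2 symmetricExchangeBinomials_subset)
  set I := Ideal.span (symmetricExchangeBinomials K B)
  -- The class of `z_w` modulo the exchange binomials; the value `1` outside `B` plays no role.
  let g : (Fin n →₀ ℕ) → MvPolynomial {w // w ∈ B} K ⧸ I := fun w =>
    if h : w ∈ B then Ideal.Quotient.mk I (MvPolynomial.X ⟨w, h⟩) else 1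
  have hgX : ∀ w : {w // w ∈ B}, g w.1 = Ideal.Quotient.mk I (MvPolynomial.X w) := fun w =>
    dif_pos w.2
  have hg : RespectsSymmetricExchange B g := by
    intro u hu v hv u' hu' v' hv' ξ ρ h1 h2 h3 h4
    rw [hgX ⟨u, hu⟩, hgX ⟨v, hv⟩, hgX ⟨u', hu'⟩, hgX ⟨v', hv'⟩, ← map_mul, ← map_mul,
      Ideal.Quotient.eq]
    exact Ideal.subset_span ⟨_, _, _, _, ξ, ρ, h1, h2, h3, h4, rfl⟩
  have hsum : ∀ {k : ℕ} (u : Fin k → {w // w ∈ B}),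
      toricExponent B (∑ i, Finsupp.single (u i) 1) = ∑ i, (u i).1 := fun u => by
    rw [map_sum]
    exact Finset.sum_congr rfl fun i _ => toricExponent_single _
  have hdm : ∀ m, (toricExponent B m).degree = m.degree * d := fun m => by
    obtain ⟨u, hu⟩ := Finsupp.exists_eq_sum_single _ m rfl
    conv_lhs => rw [hu, hsum, map_sum]
    rw [Finset.sum_congr rfl fun i _ => hdeg _ (u i).2]
    simp
  -- Positivity of `d` forces equal degrees within a fibre, so both monomials become families over
  -- the same index set.
  have hmm' : m'.degree = m.degree := by
    have := hdm m
    rw [hmm, hdm m'] at this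
    exact Nat.eq_of_mul_eq_mul_right hd this
  obtain ⟨u, hu⟩ := Finsupp.exists_eq_sum_single _ m rfl
  obtain ⟨w, hw⟩ := Finsupp.exists_eq_sum_single _ m' hmm'
  have hprod : ∀ {k : ℕ} (u : Fin k → {w // w ∈ B}), Ideal.Quotient.mk I
      (MvPolynomial.monomial (∑ i, Finsupp.single (u i) 1) 1) = ∏ i, g (u i).1 := fun u => by
    rw [MvPolynomial.monomial_sum_one, map_prod]
    exact Finset.prod_congr rfl fun i _ => (hgX _).symm
  rw [← Ideal.Quotient.eq, hu, hw, hprod, hprod]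
  refine hB.prod_eq_prod hg _ _ (fun i => (u i).2) (fun i => (w i).2) ?_
  rw [← hsum, ← hsum, ← hu, ← hw, hmm]

end BinomialGenerators

/-! ### Polymatroids with zero toric ideal -/

section DistanceOne

variable {K : Type*} [Field K] {n : ℕ} {B : Finset (Fin n →₀ ℕ)}

/-- The relation gives `z_u z_v = z_w z_{w'}` in a polynomial ring, where the variable `z_w` is
prime. -/
theorem eq_or_eq_of_toricIdeal_eq_bot (hJ : toricIdeal K B = ⊥) {u v w w' : Fin n →₀ ℕ}
    (hu : u ∈ B) (hv : v ∈ B) (hw : w ∈ B) (hw' : w' ∈ B) (h : u + v = w + w') :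
    w = u ∨ w = v := by
  have hX : ∀ w : {w // w ∈ B}, toricMap K B (MvPolynomial.X w) =
      MvPolynomial.monomial w.1 1 := fun w => by simp [toricMap]
  have hmem : (MvPolynomial.X ⟨u, hu⟩ * MvPolynomial.X ⟨v, hv⟩ -
      MvPolynomial.X ⟨w, hw⟩ * MvPolynomial.X ⟨w', hw'⟩ : MvPolynomial {w // w ∈ B} K) ∈
      toricIdeal K B := by
    change toricMap K B _ = 0
    rw [map_sub, map_mul, map_mul, hX, hX, hX, hX, MvPolynomial.monomial_mul,
      MvPolynomial.monomial_mul, h, sub_self]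
  rw [hJ, Ideal.mem_bot, sub_eq_zero] at hmem
  have hdvd : (MvPolynomial.X ⟨w, hw⟩ : MvPolynomial {w // w ∈ B} K) ∣
      MvPolynomial.X ⟨u, hu⟩ * MvPolynomial.X ⟨v, hv⟩ := hmem ▸ dvd_mul_right _ _
  rcases MvPolynomial.X_prime.dvd_or_dvd hdvd with h1 | h1
  · exact Or.inl (congrArg Subtype.val (MvPolynomial.X_dvd_X.1 h1))
  · exact Or.inr (congrArg Subtype.val (MvPolynomial.X_dvd_X.1 h1))

/-- If the monomial `1` belonged to `B`, its variable minus `1` would lie in the toric ideal. -/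
theorem degree_pos_of_toricIdeal_eq_bot (hJ : toricIdeal K B = ⊥) {u : Fin n →₀ ℕ}
    (hu : u ∈ B) : 0 < u.degree := by
  rw [Nat.pos_iff_ne_zero, Ne, Finsupp.degree_eq_zero_iff]
  rintro rfl
  have hmem : (MvPolynomial.X ⟨0, hu⟩ - 1 : MvPolynomial {w // w ∈ B} K) ∈ toricIdeal K B := by
    change toricMap K B _ = 0
    simp [toricMap]
  rw [hJ, Ideal.mem_bot, sub_eq_zero] at hmem
  exact MvPolynomial.X_prime.not_isUnit (hmem ▸ isUnit_one)

theorem IsPolymatroid.exists_exchange_of_two_step (hB : IsPolymatroid B) {u v : Fin n →₀ ℕ}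
    (hu : u ∈ B) (hv : v ∈ B) {ξ₁ ξ₂ ρ₁ ρ₂ : Fin n}
    (h : v + Finsupp.single ξ₁ 1 + Finsupp.single ξ₂ 1 =
      u + Finsupp.single ρ₁ 1 + Finsupp.single ρ₂ 1) (h11 : ξ₁ ≠ ρ₁) (h12 : ξ₁ ≠ ρ₂) :
    ∃ w ∈ B, w + Finsupp.single ξ₁ 1 = u + Finsupp.single ρ₁ 1 ∨
      w + Finsupp.single ξ₁ 1 = u + Finsupp.single ρ₂ 1 := by
  have hx : ∀ x, v x + (if ξ₁ = x then 1 else 0) + (if ξ₂ = x then 1 else 0) =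
      u x + (if ρ₁ = x then 1 else 0) + (if ρ₂ = x then 1 else 0) := fun x => by
    simpa [Finsupp.single_apply] using DFunLike.congr_fun h x
  obtain ⟨ρ, hρ, w, hw, hw'⟩ := hB.2 u hu v hv ξ₁ (by
    have := hx ξ₁
    simp only [h11.symm, h12.symm, if_true, if_false] at this
    omega)
  refine ⟨w, hw, ?_⟩
  by_cases h1 : ρ₁ = ρ
  · exact Or.inl (h1 ▸ hw')
  by_cases h2 : ρ₂ = ρ
  · exact Or.inr (h2 ▸ hw')
  have := hx ρ
  simp only [h1, h2, if_false] at this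
  omega

/-- Write $w_{ij}=x_{\rho_j}u/x_{\xi_i}$. Since $w_{11}w_{22}=w_{12}w_{21}=uv$, a zero toric ideal
forbids both members of either complementary pair from lying in `B`. The exchange axiom, applied
from `u` for each `ξ` and from `v` for each `ρ`, puts in `B` at least one end of every edge of the
4-cycle $w_{11},w_{12},w_{22},w_{21}$. Such a set contains a diagonal, which is a complementary
pair. -/
theorem IsPolymatroid.not_two_step (hB : IsPolymatroid B) (hJ : toricIdeal K B = ⊥)
    {u v : Fin n →₀ ℕ} (hu : u ∈ B) (hv : v ∈ B) {ξ₁ ξ₂ ρ₁ ρ₂ : Fin n}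
    (h : v + Finsupp.single ξ₁ 1 + Finsupp.single ξ₂ 1 =
      u + Finsupp.single ρ₁ 1 + Finsupp.single ρ₂ 1) (h11 : ξ₁ ≠ ρ₁) (h12 : ξ₁ ≠ ρ₂)
    (h21 : ξ₂ ≠ ρ₁) (h22 : ξ₂ ≠ ρ₂) : False := by
  have hinj : ∀ {i j : Fin n}, Finsupp.single i 1 = Finsupp.single j 1 → i = j := fun {i j} hij =>
    (Finsupp.single_left_inj (one_ne_zero (α := ℕ))).1 hij
  have done : ∀ {ρ₁ ρ₂ : Fin n} {w w' : Fin n →₀ ℕ},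
      v + Finsupp.single ξ₁ 1 + Finsupp.single ξ₂ 1 =
        u + Finsupp.single ρ₁ 1 + Finsupp.single ρ₂ 1 → ξ₁ ≠ ρ₁ → ξ₂ ≠ ρ₂ → w ∈ B → w' ∈ B →
      w + Finsupp.single ξ₁ 1 = u + Finsupp.single ρ₁ 1 →
      w' + Finsupp.single ξ₂ 1 = u + Finsupp.single ρ₂ 1 → False := by
    intro ρ₁ ρ₂ w w' h h1 h2 hw hw' e1 e2
    have hs : u + v = w + w' := by
      ext x
      have a1 := DFunLike.congr_fun h x
      have a2 := DFunLike.congr_fun e1 x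
      have a3 := DFunLike.congr_fun e2 x
      simp only [Finsupp.add_apply] at a1 a2 a3 ⊢
      omega
    rcases eq_or_eq_of_toricIdeal_eq_bot hJ hu hv hw hw' hs with rfl | rfl
    · exact h1 (hinj (add_left_cancel e1))
    · rw [e1] at h
      exact h2 (hinj (add_left_cancel h))
  have hswap : v + Finsupp.single ξ₁ 1 + Finsupp.single ξ₂ 1 =
      u + Finsupp.single ρ₂ 1 + Finsupp.single ρ₁ 1 := h.trans (add_right_comm _ _ _)
  have hcompl : ∀ {ξ ξ' ρ ρ' : Fin n} {w : Fin n →₀ ℕ},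
      v + Finsupp.single ξ 1 + Finsupp.single ξ' 1 =
        u + Finsupp.single ρ 1 + Finsupp.single ρ' 1 →
      w + Finsupp.single ρ 1 = v + Finsupp.single ξ 1 →
      w + Finsupp.single ξ' 1 = u + Finsupp.single ρ' 1 := by
    intro ξ ξ' ρ ρ' w h e
    ext x
    have a1 := DFunLike.congr_fun h x
    have a2 := DFunLike.congr_fun e x
    simp only [Finsupp.add_apply] at a1 a2 ⊢
    omega
  have hc' : v + Finsupp.single ξ₂ 1 + Finsupp.single ξ₁ 1 =
      u + Finsupp.single ρ₁ 1 + Finsupp.single ρ₂ 1 := (add_right_comm _ _ _).trans h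
  obtain ⟨w₁, hw₁, r₁⟩ := hB.exists_exchange_of_two_step hu hv h h11 h12
  obtain ⟨w₂, hw₂, r₂⟩ := hB.exists_exchange_of_two_step hu hv hc' h21 h22
  obtain ⟨w₃, hw₃, r₃⟩ := hB.exists_exchange_of_two_step hv hu h.symm h11.symm h21.symm
  obtain ⟨w₄, hw₄, r₄⟩ := hB.exists_exchange_of_two_step hv hu hswap.symm h12.symm h22.symm
  have r₃' := r₃.imp (hcompl h) (hcompl hc')
  have r₄' := r₄.imp (hcompl hswap) (hcompl (hc'.trans (add_right_comm _ _ _)))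
  rcases r₁ with r₁ | r₁ <;> rcases r₂ with r₂ | r₂
  · rcases r₃' with r₃ | r₃
    · exact done h h11 h22 hw₁ hw₃ r₁ r₃
    · exact done hswap h12 h21 hw₃ hw₂ r₃ r₂
  · exact done h h11 h22 hw₁ hw₂ r₁ r₂
  · exact done hswap h12 h21 hw₁ hw₂ r₁ r₂
  · rcases r₄' with r₄ | r₄
    · exact done hswap h12 h21 hw₁ hw₄ r₁ r₄
    · exact done h h11 h22 hw₄ hw₂ r₄ r₂

/-- Any two elements of a polymatroid with zero toric ideal differ by a single exchange. -/
theorem IsPolymatroid.exists_single_exchange (hB : IsPolymatroid B) (hJ : toricIdeal K B = ⊥)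
    {u v : Fin n →₀ ℕ} (hu : u ∈ B) (hv : v ∈ B) :
    ∃ a b, v + Finsupp.single a 1 = u + Finsupp.single b 1 := by
  induction hc : ∑ x, (u x - v x) using Nat.strong_induction_on generalizing u with
  | _ c ih =>
    by_cases hle : ∀ x, u x ≤ v x
    · have huv : u = v := by
        have hdeg := hB.1 u hu v hv
        rw [Finsupp.degree_eq_sum, Finsupp.degree_eq_sum] at hdeg
        ext x
        exact (Finset.sum_eq_sum_iff_of_le fun i _ => hle i).1 hdeg x (Finset.mem_univ x)
      -- The trivial trade of a variable for itself needs some variable to exist, which positive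
      -- degree guarantees.
      have hpos := degree_pos_of_toricIdeal_eq_bot hJ hu
      obtain ⟨x⟩ : Nonempty (Fin n) := by
        by_contra hn
        rw [not_nonempty_iff] at hn
        rw [Subsingleton.elim u 0] at hpos
        simp at hpos
      exact ⟨x, x, by rw [huv]⟩
    push Not at hle
    obtain ⟨ξ, hξ⟩ := hle
    obtain ⟨ρ, hρ, w, hw, e⟩ := hB.2 u hu v hv ξ hξ
    have hne : ξ ≠ ρ := by rintro rfl; omega
    have hlt : ∑ x, (w x - v x) < c := by
      rw [← hc]
      refine Finset.sum_lt_sum (fun x _ => ?_) ⟨ξ, Finset.mem_univ _, ?_⟩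
      · have := apply_of_add_single_eq e x
        rcases eq_or_ne ρ x with rfl | hx
        · simp only [hne, if_true, if_false] at this
          omega
        · simp only [hx, if_false] at this
          omega
      · have := apply_of_add_single_eq e ξ
        simp only [hne.symm, if_true, if_false] at this
        omega
    obtain ⟨a, b, hab⟩ := ih _ hlt hw rfl
    -- One axiom step followed by the inductive trade makes two trades; unless a cancellation
    -- reduces them to one, `not_two_step` applies.
    have hstep : v + Finsupp.single ξ 1 + Finsupp.single a 1 =
        u + Finsupp.single ρ 1 + Finsupp.single b 1 := by
      rw [add_right_comm, hab, add_right_comm, e]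
    by_cases h1 : a = b
    · subst h1
      exact ⟨ξ, ρ, add_right_cancel hstep⟩
    by_cases h2 : a = ρ
    · subst h2
      refine ⟨ξ, b, ?_⟩
      rw [add_right_comm u] at hstep
      exact add_right_cancel hstep
    by_cases h3 : ξ = b
    · subst h3
      refine ⟨a, ρ, ?_⟩
      rw [add_right_comm v] at hstep
      exact add_right_cancel hstep
    exact (hB.not_two_step hJ hu hv hstep hne h3 h2 h1).elim

end DistanceOne

/-! ### Products and transversal polymatroids -/

theorem mem_polymatroidProduct {n s : ℕ} {B : Fin s → Finset (Fin n →₀ ℕ)} {w : Fin n →₀ ℕ} :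
    w ∈ polymatroidProduct B ↔ ∃ u : Fin s → Fin n →₀ ℕ, (∀ i, u i ∈ B i) ∧ ∑ i, u i = w := by
  simp [polymatroidProduct, Fintype.mem_piFinset]

/-- The trades are indexed by the factors: performing those in `I` replaces `u i` by `v i` for `i ∈
I`, which stays in the product. Trades that overlap are then cancelled. -/
theorem isStronglyOrderable_polymatroidProduct {n s : ℕ} {B : Fin s → Finset (Fin n →₀ ℕ)}
    (h : ∀ i, ∀ u ∈ B i, ∀ v ∈ B i, ∃ a b, v + Finsupp.single a 1 = u + Finsupp.single b 1) :
    IsStronglyOrderable (Fin s) (polymatroidProduct B) := by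
  intro _ hu' _ hv'
  obtain ⟨u, hu, rfl⟩ := mem_polymatroidProduct.1 hu'
  obtain ⟨v, hv, rfl⟩ := mem_polymatroidProduct.1 hv'
  choose a b hab using fun i => h i (u i) (hu i) (v i) (hv i)
  refine IsExchangeSystem.exists_disjoint (S := Finset.univ) (a := a) (b := b) ?_ ?_
  · intro I _
    refine ⟨_, mem_polymatroidProduct.2 ⟨fun i => if i ∈ I then v i else u i, fun i => ?_, rfl⟩, ?_⟩
    · dsimp only
      split_ifs
      exacts [hv i, hu i]
    · rw [← Finset.sum_filter_add_sum_filter_not Finset.univ (· ∈ I) u,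
        ← Finset.sum_filter_add_sum_filter_not Finset.univ (· ∈ I)
          (fun i => if i ∈ I then v i else u i), Finset.filter_univ_mem,
        Finset.sum_congr rfl (fun i (hi : i ∈ I) => if_pos hi),
        Finset.sum_congr rfl (fun i hi => if_neg (Finset.mem_filter.1 hi).2),
        add_right_comm, add_right_comm (∑ i ∈ I, u i)]
      have : ∑ i ∈ I, v i + ∑ i ∈ I, Finsupp.single (a i) 1 =
          ∑ i ∈ I, u i + ∑ i ∈ I, Finsupp.single (b i) 1 := by
        rw [← Finset.sum_add_distrib, ← Finset.sum_add_distrib]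
        exact Finset.sum_congr rfl fun i _ => hab i
      exact congrArg (· + _) this
  · rw [← Finset.sum_add_distrib, ← Finset.sum_add_distrib]
    exact Finset.sum_congr rfl fun i _ => hab i

theorem IsTransversalPolymatroid.toricIdeal_eq_span (K : Type*) [Field K] {n : ℕ}
    {B : Finset (Fin n →₀ ℕ)} (hB : IsTransversalPolymatroid B) :
    toricIdeal K B = Ideal.span (symmetricExchangeBinomials K B) := by
  obtain ⟨d, A, hd, -, hA⟩ := hB
  have hBA : B = polymatroidProduct fun k => (A k).image fun i => Finsupp.single i 1 := by
    ext w
    rw [hA, mem_polymatroidProduct]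
    constructor
    · rintro ⟨i, hi, rfl⟩
      exact ⟨_, fun k => Finset.mem_image_of_mem _ (hi k), rfl⟩
    · rintro ⟨u, hu, rfl⟩
      choose i hi hui using fun k => Finset.mem_image.1 (hu k)
      exact ⟨i, hi, Finset.sum_congr rfl fun k _ => (hui k).symm⟩
  have hdeg : ∀ u ∈ B, u.degree = d := by
    intro u hu
    obtain ⟨i, -, rfl⟩ := (hA u).1 hu
    simp [map_sum]
  have hS : IsStronglyOrderable (Fin d) B := by
    rw [hBA]
    refine isStronglyOrderable_polymatroidProduct fun k u hu v hv => ?_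
    obtain ⟨i, -, rfl⟩ := Finset.mem_image.1 hu
    obtain ⟨j, -, rfl⟩ := Finset.mem_image.1 hv
    exact ⟨i, j, add_comm _ _⟩
  exact hS.toricIdeal_eq_span hd hdeg

theorem toricIdeal_polymatroidProduct_eq_span (K : Type*) [Field K] {n s : ℕ}
    (B : Fin s → Finset (Fin n →₀ ℕ)) (hs : 0 < s) (hB : ∀ i, IsPolymatroid (B i))
    (hJ : ∀ i, toricIdeal K (B i) = ⊥) :
    toricIdeal K (polymatroidProduct B) =
      Ideal.span (symmetricExchangeBinomials K (polymatroidProduct B)) := by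
  have hS := isStronglyOrderable_polymatroidProduct (B := B)
    fun i u hu v hv => (hB i).exists_single_exchange (hJ i) hu hv
  rcases (polymatroidProduct B).eq_empty_or_nonempty with he | ⟨w, hw⟩
  -- With no monomials every degree condition is vacuous, so `1` serves as the degree.
  · exact hS.toricIdeal_eq_span one_pos fun u hu => by simp [he] at hu
  · obtain ⟨u, hu, -⟩ := mem_polymatroidProduct.1 hw
    refine hS.toricIdeal_eq_span (d := ∑ i, (u i).degree) ?_ fun _ hv' => ?_
    · have : Nonempty (Fin s) := ⟨⟨0, hs⟩⟩
      exact Finset.sum_pos (fun i _ => degree_pos_of_toricIdeal_eq_bot (hJ i) (hu i))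
        Finset.univ_nonempty
    · obtain ⟨v, hv, rfl⟩ := mem_polymatroidProduct.1 hv'
      rw [map_sum]
      exact Finset.sum_congr rfl fun i _ => (hB i).1 _ (hv i) _ (hu i)

theorem corollary4p2 (K : Type*) [Field K] (n : ℕ) :
    (∀ (s : ℕ) (B : Fin s → Finset (Fin n →₀ ℕ)), 0 < s →
      (∀ i, IsPolymatroid (B i)) → (∀ i, toricIdeal K (B i) = ⊥) →
        toricIdeal K (polymatroidProduct B) =
          Ideal.span (symmetricExchangeBinomials K (polymatroidProduct B))) ∧
    (∀ B : Finset (Fin n →₀ ℕ), IsTransversalPolymatroid B →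
      toricIdeal K B = Ideal.span (symmetricExchangeBinomials K B)) :=
  ⟨fun _ B hs hB hJ => toricIdeal_polymatroidProduct_eq_span K B hs hB hJ,
    fun _ hB => hB.toricIdeal_eq_span K⟩
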